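/- **Setting.** A *rooted tree* is a finite tree with a distinguished vertex (the root), all of whose edges are oriented toward the root. A *topological rooted tree* is an isomorphism class of rooted trees. Topological rooted trees are generated recursively by the one-vertex tree $\bullet$ and by $[t_1,\dots,t_m]$ ($m\ge 1$), the tree obtained by grafting the roots of $t_1,\dots,t_m$ to a new root; the order of the $t_i$ is irrelevant. For $p$ in the open upper half plane $\mathcal H\subset\mathbb C$ and $q\in\mathcal H\cup\mathbb R$, $q\neq p$, let $$\phi(p,q)=\frac1{2\pi}\arg\frac{q-p}{q-\bar p}\in[0,1)$$ be the normalized hyperbolic angle at $p$ from the vertical direction to the geodesic from $p$ to $q$, where $\arg$ is taken in $[0,2\pi)$. To a rooted tree $t$ with $n$ vertices, associate the Kontsevich graph $\Gamma_t$ of type $(n,2)$: its aerial vertices are the vertices of $t$, its terrestrial vertices are $\bar 1,\bar 2$, and each aerial vertex $k$ has exactly two ordered outgoing edges. The first edge of $k$ goes to $\bar 1$; the second edge goes to the parent of $k$ in $t$ if $k$ is not the root, and to $\bar 2$ if $k$ is the root. Let $M_n$ be the set of $n$-tuples $z=(z_k)$ of distinct points of $\mathcal H$, oriented by $\bigwedge_k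 dx_k\wedge dy_k$ with $z_k=x_k+iy_k$. Place $\bar1$ at $0$ and $\bar 2$ at $1$, and let $\phi_k^i$ be $\phi(z_k,\cdot)$ evaluated at the position of the end point of the $i$-th edge of $k$. The Kontsevich weight of $t$, in Kathotia's normalization, is $$W_t=W_{\Gamma_t}=\int_{M_n}\bigwedge_{k}d\phi_k^1\wedge d\phi_k^2 ,$$ where $d\phi_k^i$ is the differential of $\phi_k^i$ as a function with values in $\mathbb R/\mathbb Z$. Define functions $I_t$ recursively by $I_\bullet(\theta)=\frac12-\theta$ and $$I_{[t_1,\dots,t_m]}(\theta)=\int_0^1 d\bar\lambda\int_\theta^{\bar\lambda}d\bar\theta\; I_{t_1}(\bar\theta)\cdots I_{t_m}(\bar\theta).$$ **Proposition.** For every rooted tree $t$ the integral defining $W_t$ converges absolutely. Every rooted tree belongs to a topological rooted tree given by a bracket expression as above, and $$W_t=I_t(0),$$ where $I_t$ is computed from any bracket expression of the isomorphism class of $t$. In particular, $W_\bullet=\frac12$, $W_{[\bullet]}=\frac1{12}$, $W_{[\bullet,\bullet]}=\frac1{24}$ and $W_{[[\bullet]]}=0$. -/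

import Mathlib

open MeasureTheory

/-- A rooted tree with vertex set `V`: a directed graph whose edges `v ⟶ w` are those with
`parent v = some w`. All edges are oriented toward the root: every vertex other than the root has
exactly one outgoing edge, the root has none, and from every vertex one arrives at the root by
following the edges. -/
structure RootedTreeOn (V : Type*) where
  root : V
  parent : V → Option V
  parent_eq_none_iff : ∀ v, parent v = none ↔ v = root
  reaches_root : ∀ v, Relation.ReflTransGen (fun a b => parent a = some b) v root

/-- An isomorphism of rooted trees: a bijection of the vertices that respects the edges (and
hence the root, the only vertex without outgoing edge). -/
structure RootedTreeOn.Iso {V V' : Type*} (t : RootedTreeOn V) (t' : RootedTreeOn V')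
    extends V ≃ V' where
  map_parent : ∀ v, t'.parent (toFun v) = (t.parent v).map toFun

theorem RootedTreeOn.parent_ne_self {V : Type*} (t : RootedTreeOn V) (v : V) :
    t.parent v ≠ some v := by
  intro h
  have key : ∀ w, Relation.ReflTransGen (fun a b => t.parent a = some b) v w → w = v := by
    intro w hw
    induction hw with
    | refl => rfl
    | tail _ hbc ih =>
      subst ih
      rw [h] at hbc
      exact (Option.some.inj hbc).symm
  have hr := key _ (t.reaches_root v)
  rw [(t.parent_eq_none_iff v).2 hr.symm] at h
  cases h

/-- The bracket expressions `•` and `[t₁, …, tₘ]` (with `m = k + 1 ≥ 1`) that denote the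
topological rooted trees, i.e. the isomorphism classes of finite rooted trees. -/
inductive BracketTree : Type
  | bullet : BracketTree
  | graft (k : ℕ) (ts : Fin (k + 1) → BracketTree) : BracketTree

namespace BracketTree

/-- The vertices of the tree denoted by a bracket expression; `none` is the root of a graft. -/
def Vert : BracketTree → Type
  | bullet => Unit
  | graft k ts => Option (Σ i : Fin (k + 1), Vert (ts i))

instance instFintypeVert : (e : BracketTree) → Fintype e.Vert
  | bullet => inferInstanceAs (Fintype Unit)
  | graft k ts =>
    letI : ∀ i, Fintype (ts i).Vert := fun i => instFintypeVert (ts i)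
    inferInstanceAs (Fintype (Option (Σ i : Fin (k + 1), (ts i).Vert)))

instance instDecidableEqVert : (e : BracketTree) → DecidableEq e.Vert
  | bullet => inferInstanceAs (DecidableEq Unit)
  | graft k ts =>
    letI : ∀ i, DecidableEq (ts i).Vert := fun i => instDecidableEqVert (ts i)
    inferInstanceAs (DecidableEq (Option (Σ i : Fin (k + 1), (ts i).Vert)))

end BracketTree

/-- The one-vertex rooted tree. -/
def RootedTreeOn.single : RootedTreeOn Unit where
  root := ()
  parent _ := none
  parent_eq_none_iff _ := by simp
  reaches_root _ := Relation.ReflTransGen.refl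

/-- Grafting the roots of the trees `ts i` to a new root `none`. -/
def RootedTreeOn.graft {ι : Type*} {V : ι → Type*} (ts : ∀ i, RootedTreeOn (V i)) :
    RootedTreeOn (Option (Σ i, V i)) where
  root := none
  parent
    | none => none
    | some ⟨i, v⟩ => some (((ts i).parent v).map (Sigma.mk i))
  parent_eq_none_iff v := by
    rcases v with _ | ⟨i, v⟩ <;> simp
  reaches_root v := by
    rcases v with _ | ⟨i, v⟩
    · exact Relation.ReflTransGen.refl
    · refine Relation.ReflTransGen.tail (b := some ⟨i, (ts i).root⟩) ?_ ?_
      · refine Relation.ReflTransGen.lift (fun w => (some ⟨i, w⟩ : Option (Σ i, V i)))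
          (fun a b h => ?_) _ _ ((ts i).reaches_root v)
        simp only [Function.onFun, h, Option.map_some]
      · simp [((ts i).parent_eq_none_iff _).2 rfl]

/-- The rooted tree denoted by a bracket expression. -/
def BracketTree.toRootedTree : (e : BracketTree) → RootedTreeOn e.Vert
  | .bullet => RootedTreeOn.single
  | .graft _ ts => RootedTreeOn.graft fun i => (ts i).toRootedTree

/-- The functions `I_t`:
`I_•(θ) = 1/2 - θ` and `I_[t₁,…,tₘ](θ) = ∫₀¹ dlam ∫_θ^lam ds I_{t₁}(s) ⋯ I_{tₘ}(s)`. -/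
noncomputable def BracketTree.I : BracketTree → ℝ → ℝ
  | .bullet => fun θ => 1 / 2 - θ
  | .graft _ ts => fun θ => ∫ lam in (0 : ℝ)..1, ∫ s in θ..lam, ∏ i, (ts i).I s

/-- A Kontsevich graph with set `V` of aerial vertices and terrestrial vertices `Fin m`
(`0`, `1`, … standing for the first, the second, …): every aerial vertex has a first and a second
outgoing edge (`target k 0` and `target k 1` are their end points), there are no other edges, and
loops are not allowed. -/
structure KontsevichGraph (V : Type*) (m : ℕ) where
  target : V → Fin 2 → V ⊕ Fin m
  no_loop : ∀ k i, target k i ≠ Sum.inl k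

/-- The Kontsevich tree `Γ_t`: its interior is `t`, all terrestrial edges land on the first
terrestrial vertex and are first edges, except that the second edge of the root lands on
the second terrestrial vertex. -/
def RootedTreeOn.kontsevichTree {V : Type*} (t : RootedTreeOn V) : KontsevichGraph V 2 where
  target k i :=
    if i = 0 then Sum.inr 0
    else
      match t.parent k with
      | some w => Sum.inl w
      | none => Sum.inr 1
  no_loop k i := by
    have h := t.parent_ne_self k
    split_ifs
    · simp
    · cases hk : t.parent k with
      | none => simp
      | some w => rw [hk] at h; simpa using h

/-- The angle function with values in `[0, 1)`: the hyperbolic angle at `p`, counterclockwise and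
divided by `2π`, from the vertical line through `p` to the geodesic from `p` to `q`. -/
noncomputable def angle (p q : ℂ) : ℝ :=
  Int.fract (Complex.arg ((q - p) / (q - (starRingEnd ℂ) p)) / (2 * Real.pi))

/-- The configuration space: tuples of distinct points of the open upper half plane. -/
def configSpace (V : Type*) : Set (V → ℂ) :=
  {z | (∀ k, 0 < (z k).im) ∧ Function.Injective z}

namespace KontsevichGraph

variable {V : Type*}

/-- The position of a vertex in a configuration: the two terrestrial vertices sit at `0`, `1`. -/
def position (z : V → ℂ) : V ⊕ Fin 2 → ℂ
  | Sum.inl k => z k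
  | Sum.inr j => ![0, 1] j

/-- The angle function of the `i`-th edge of `k`. -/
noncomputable def edgeAngle (Γ : KontsevichGraph V 2) (k : V) (i : Fin 2) (z : V → ℂ) : ℝ :=
  angle (z k) (position z (Γ.target k i))

variable [Fintype V] [DecidableEq V]

/-- The density of the angle form `⋀ₖ dφₖ¹ ∧ dφₖ²` with respect to the volume form
`⋀ₖ dxₖ ∧ dyₖ`, where `zₖ = xₖ + i yₖ`: the Jacobian determinant of the `2n` angle functions.
(An angle jumps from `1` to `0` where `p` lies vertically below `q`; this set of configurations
is a null set.) -/
noncomputable def angleFormDensity (Γ : KontsevichGraph V 2) (z : V → ℂ) : ℝ :=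
  Matrix.det (Matrix.of fun (a b : V × Fin 2) =>
    fderiv ℝ (Γ.edgeAngle a.1 a.2) z (Pi.single b.1 (![1, Complex.I] b.2)))

/-- The Kontsevich weight, the integral of the angle form over the configuration space (the
boundary of its compactification does not contribute). Neither a factor `1 / n!` nor powers
of `2π` occur, as the angles are in `[0, 1)`. -/
noncomputable def weight (Γ : KontsevichGraph V 2) : ℝ :=
  ∫ z in configSpace V, Γ.angleFormDensity z

end KontsevichGraph

/-- The Kontsevich weight `W_t` of a rooted tree. -/
noncomputable def RootedTreeOn.weight {V : Type*} [Fintype V] [DecidableEq V]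
    (t : RootedTreeOn V) : ℝ :=
  t.kontsevichTree.weight

/-!
Every edge of `Γ_t` ends at a terrestrial vertex or at the parent of its source, so the Jacobian
matrix of the angles is block triangular with respect to the depth, and the angle form is almost
everywhere the product over the vertices `v` of the forms `dφ(z_v, 0) ∧ dφ(z_v, q_v)` in `z_v`,
where `q_v` is the position of the parent of `v` (and `q_v = 1` for the root).

Such a product is integrated from the leaves to the root. Along the ray `ℝ₊ e^{iα}` the form
`dφ(p, 0) ∧ dφ(p, q)` is `dα` times the differential of an argument, so the integral over the ray
only sees limits of arguments: it is `(1_{arg q < α} - α / π) / π`, and the integral of the absolute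
value is at most `1 / π`. Hence each vertex contributes at most `1` in absolute value, and if the
branches at `p` contribute a function `G` of `s = arg p / π`, then the vertex at `p` contributes
`∫₀¹ (1_{θ < s} - s) G(s) ds` with `θ = arg q / π`. Integration by parts turns this into
`∫₀¹ dlam ∫_θ^lam ds G(s)`, the recursion defining `I_t`; at the root, `arg 1 = 0`. -/

namespace RootedTreeOn

variable {V V' V'' : Type*}

theorem parent_root (t : RootedTreeOn V) : t.parent t.root = none :=
  (t.parent_eq_none_iff _).2 rfl

theorem wellFounded_parent (t : RootedTreeOn V) :
    WellFounded fun a b => t.parent b = some a := by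
  refine ⟨fun v => ?_⟩
  induction t.reaches_root v using Relation.ReflTransGen.head_induction_on with
  | refl => exact ⟨_, fun w hw => by simp [t.parent_root] at hw⟩
  | head hparent _ ih => exact ⟨_, fun w hw => by rwa [← Option.some.inj (hparent.symm.trans hw)]⟩

/-- `t.Reaches x v` says that the path from `x` to the root passes through `v`. -/
abbrev Reaches (t : RootedTreeOn V) : V → V → Prop :=
  Relation.ReflTransGen fun a b => t.parent a = some b

theorem not_reaches_of_parent_eq (t : RootedTreeOn V) {v w : V} (h : t.parent v = some w) :
    ¬ t.Reaches w v := by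
  intro hwv
  have hcycle : Relation.TransGen (Function.swap fun a b => t.parent a = some b) v v :=
    Relation.transGen_swap.2 (Relation.TransGen.head' h hwv)
  exact t.wellFounded_parent.transGen.irrefl.irrefl v hcycle

theorem eq_of_reaches_siblings (t : RootedTreeOn V) {x a b v : V}
    (hxa : t.Reaches x a) (hxb : t.Reaches x b)
    (ha : t.parent a = some v) (hb : t.parent b = some v) : a = b := by
  have eq_of_reaches {a b : V} (ha : t.parent a = some v) (hb : t.parent b = some v)
      (hab : t.Reaches a b) : a = b := by
    rcases hab.cases_head with hab | ⟨c, hac, hcb⟩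
    · exact hab
    · obtain rfl : v = c := Option.some.inj (ha.symm.trans hac)
      exact (t.not_reaches_of_parent_eq hb hcb).elim
  have parent_unique : Relator.RightUnique fun a b => t.parent a = some b :=
    fun _ _ _ h h' => Option.some.inj (h.symm.trans h')
  rcases Relation.ReflTransGen.total_of_right_unique parent_unique hxa hxb with hab | hba
  · exact eq_of_reaches ha hb hab
  · exact (eq_of_reaches hb ha hba).symm

open Classical in
/-- The branch of `t` at `v`: the rooted tree of all vertices that reach `v`. -/
noncomputable def branch (t : RootedTreeOn V) (v : V) : RootedTreeOn {x // t.Reaches x v} where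
  root := ⟨v, .refl⟩
  parent x := (t.parent x).bind fun y => if h : t.Reaches y v then some ⟨y, h⟩ else none
  parent_eq_none_iff := by
    rintro ⟨x, hx⟩
    rw [Subtype.mk.injEq]
    refine ⟨fun hnone => ?_, ?_⟩
    · rcases hx.cases_head with hxv | ⟨y, hxy, hyv⟩
      · exact hxv
      · simp [hxy, hyv] at hnone
    · rintro rfl
      rw [Option.bind_eq_none_iff]
      exact fun y hy => dif_neg (t.not_reaches_of_parent_eq hy)
  reaches_root := by
    rintro ⟨x, hx⟩
    induction hx using Relation.ReflTransGen.head_induction_on with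
    | refl => exact .refl
    | head hparent hyv ih => exact .head (by simp [hparent, hyv]) ih

theorem parent_of_parent_branch (t : RootedTreeOn V) {v : V} {x y : {x // t.Reaches x v}}
    (h : (t.branch v).parent x = some y) : t.parent x = some y := by
  obtain ⟨z, hz, hzy⟩ := Option.bind_eq_some_iff.1 h
  split at hzy
  · obtain rfl := Option.some.inj hzy
    exact hz
  · cases hzy

namespace Iso

/-- A bijection that maps edges to edges and the root to the root is an isomorphism. -/
def ofEquiv {t : RootedTreeOn V} {t' : RootedTreeOn V'} (σ : V ≃ V') (hroot : σ t.root = t'.root)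
    (hparent : ∀ v w, t.parent v = some w → t'.parent (σ v) = some (σ w)) : t.Iso t' where
  toEquiv := σ
  map_parent v := by
    cases hv : t.parent v with
    | none =>
      rw [(t.parent_eq_none_iff v).1 hv, Option.map_none]
      exact (t'.parent_eq_none_iff _).2 hroot
    | some w => exact hparent v w hv

/-- The inverse of an isomorphism. -/
def symm {t : RootedTreeOn V} {t' : RootedTreeOn V'} (σ : t.Iso t') : t'.Iso t where
  toEquiv := σ.toEquiv.symm
  map_parent v := by
    obtain ⟨v, rfl⟩ := σ.toEquiv.surjective v
    have hv : t'.parent (σ.toEquiv v) = (t.parent v).map σ.toEquiv := σ.map_parent v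
    change t.parent (σ.toEquiv.symm (σ.toEquiv v)) = (t'.parent (σ.toEquiv v)).map σ.toEquiv.symm
    simp [hv]

/-- The composition of isomorphisms. -/
def trans {t : RootedTreeOn V} {t' : RootedTreeOn V'} {t'' : RootedTreeOn V''}
    (σ : t.Iso t') (τ : t'.Iso t'') : t.Iso t'' where
  toEquiv := σ.toEquiv.trans τ.toEquiv
  map_parent v := (τ.map_parent (σ.toFun v)).trans <| by
    rw [σ.map_parent, Option.map_map]
    rfl

/-- Grafting respects isomorphisms; the order of the grafted trees is irrelevant. -/
def graftCongr {ι ι' : Type*} {W : ι → Type*} {W' : ι' → Type*} {ts : ∀ i, RootedTreeOn (W i)}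
    {ts' : ∀ i, RootedTreeOn (W' i)} (e : ι ≃ ι') (σ : ∀ i, (ts i).Iso (ts' (e i))) :
    (graft ts).Iso (graft ts') where
  toEquiv := Equiv.optionCongr (Equiv.sigmaCongr e fun i => (σ i).toEquiv)
  map_parent
    | none => rfl
    | some ⟨i, v⟩ => by
      have hv := (σ i).map_parent v
      change some (((ts' (e i)).parent ((σ i).toFun v)).map (Sigma.mk (e i))) =
        some ((((ts i).parent v).map (Sigma.mk i)).map _)
      rw [hv]
      cases (ts i).parent v <;> rfl

/-- A tree is obtained by grafting the branches at the children of its root. -/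
noncomputable def graftBranches (t : RootedTreeOn V) :
    (graft fun c : {c // t.parent c = some t.root} => t.branch c).Iso t :=
  let vertex : Option (Σ c : {c // t.parent c = some t.root}, {x // t.Reaches x c}) → V :=
    fun o => o.elim t.root fun s => s.2
  have root_ne (c : {c // t.parent c = some t.root}) : ∀ x : {x // t.Reaches x c}, t.root ≠ x := by
    rintro ⟨x, hx⟩ rfl
    exact t.not_reaches_of_parent_eq c.2 hx
  have vertex_injective : Function.Injective vertex := by
    rintro (_ | ⟨c, x⟩) (_ | ⟨d, y⟩) h
    · rfl
    · exact (root_ne d y h).elim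
    · exact (root_ne c x h.symm).elim
    · obtain ⟨x, hx⟩ := x
      obtain ⟨y, hy⟩ := y
      obtain rfl : x = y := h
      obtain rfl : c = d := Subtype.ext (t.eq_of_reaches_siblings hx hy c.2 d.2)
      rfl
  have vertex_surjective : Function.Surjective vertex := by
    intro x
    rcases (t.reaches_root x).cases_tail with hx | ⟨c, hxc, hc⟩
    · exact ⟨none, hx⟩
    · exact ⟨some ⟨⟨c, hc⟩, ⟨x, hxc⟩⟩, rfl⟩
  ofEquiv (Equiv.ofBijective vertex ⟨vertex_injective, vertex_surjective⟩) rfl <| by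
    rintro (_ | ⟨c, x⟩) y h
    · cases h
    · obtain rfl := Option.some.inj h
      change t.parent x = some (vertex _)
      cases hx : (t.branch c).parent x with
      | none =>
        rw [((t.branch c).parent_eq_none_iff x).1 hx]
        exact c.2
      | some y => exact t.parent_of_parent_branch hx

end Iso

theorem card_branch_lt [Finite V] (t : RootedTreeOn V) {c v : V} (hc : t.parent c = some v) :
    Nat.card {x // t.Reaches x c} < Nat.card V :=
  Finite.card_subtype_lt (t.not_reaches_of_parent_eq hc)

theorem exists_iso_bracketTree [Finite V] (t : RootedTreeOn V) :
    ∃ e : BracketTree, Nonempty (t.Iso e.toRootedTree) := by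
  induction hn : Nat.card V using Nat.strong_induction_on generalizing V with
  | _ n ih =>
  subst hn
  choose e σ using fun c : {c // t.parent c = some t.root} =>
    ih _ (t.card_branch_lt c.2) (t.branch c) rfl
  obtain ⟨m, ⟨ν⟩⟩ := Finite.exists_equiv_fin {c // t.parent c = some t.root}
  cases m with
  | zero =>
    have : IsEmpty {c // t.parent c = some t.root} := ν.isEmpty
    refine ⟨.bullet, ⟨(Iso.graftBranches t).symm.trans
      (.ofEquiv (Equiv.equivPUnit _) rfl ?_)⟩⟩
    rintro (_ | ⟨c, _⟩) w h
    · cases h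
    · exact (this.false c).elim
  | succ k =>
    refine ⟨.graft k (e ∘ ν.symm), ⟨(Iso.graftBranches t).symm.trans
      (.graftCongr ν fun c => ?_)⟩⟩
    rw [Function.comp_apply, Equiv.symm_apply_apply]
    exact (σ c).some

end RootedTreeOn

open Complex Filter Set
open UpperHalfPlane (upperHalfPlaneSet isOpen_upperHalfPlaneSet)
open scoped Real ComplexConjugate Topology

section RayIntegral

variable {a : ℂ}

theorem ofReal_add_mem_slitPlane (ha : a ∈ slitPlane) {r : ℝ} (hr : 0 ≤ r) :
    (r + a : ℂ) ∈ slitPlane := by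
  rw [mem_slitPlane_iff] at ha ⊢
  rw [add_re, add_im, ofReal_re, ofReal_im, zero_add]
  exact ha.imp_left fun h => by linarith

theorem hasDerivAt_arg_ofReal_add {r : ℝ} (h : (r + a : ℂ) ∈ slitPlane) :
    HasDerivAt (fun r : ℝ => arg (r + a)) ((r + a : ℂ)⁻¹).im r := by
  have hlog : HasDerivAt (fun r : ℝ => log (r + a)) (r + a : ℂ)⁻¹ r := by
    simpa using ((ofRealCLM.hasDerivAt (x := r)).add_const a).clog_real h
  simpa [Function.comp_def, log_im] using imCLM.hasFDerivAt.comp_hasDerivAt r hlog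

theorem tendsto_arg_ofReal_add (a : ℂ) :
    Tendsto (fun r : ℝ => arg (r + a)) atTop (𝓝 0) := by
  have hdiv : Tendsto (fun r : ℝ => 1 + a * ((r⁻¹ : ℝ) : ℂ)) atTop (𝓝 1) := by
    simpa using ((continuous_ofReal.tendsto 0).comp tendsto_inv_atTop_zero).const_mul a
      |>.const_add (1 : ℂ)
  have harg := (continuousAt_arg one_mem_slitPlane).tendsto.comp hdiv
  rw [arg_one] at harg
  refine harg.congr' ?_
  filter_upwards [eventually_gt_atTop 0] with r hr
  rw [Function.comp_apply, ← arg_real_mul _ hr]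
  have : (r : ℂ) ≠ 0 := ofReal_ne_zero.2 hr.ne'
  congr 1
  push_cast
  field_simp

theorem im_inv_ofReal_add (r : ℝ) : ((r + a : ℂ)⁻¹).im = -a.im / normSq (r + a) := by
  simp [inv_im]

theorem im_inv_ofReal_add_nonneg_or_nonpos (a : ℂ) :
    (∀ r : ℝ, 0 ≤ ((r + a : ℂ)⁻¹).im) ∨ ∀ r : ℝ, ((r + a : ℂ)⁻¹).im ≤ 0 := by
  simp only [im_inv_ofReal_add]
  rcases le_total a.im 0 with h | h
  · exact .inl fun r => div_nonneg (neg_nonneg.2 h) (normSq_nonneg _)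
  · exact .inr fun r => div_nonpos_of_nonpos_of_nonneg (neg_nonpos.2 h) (normSq_nonneg _)

theorem integrableOn_im_inv_ofReal_add (ha : a ∈ slitPlane) :
    IntegrableOn (fun r : ℝ => ((r + a : ℂ)⁻¹).im) (Ioi 0) := by
  have hderiv (r : ℝ) (hr : r ∈ Ici 0) :=
    hasDerivAt_arg_ofReal_add (ofReal_add_mem_slitPlane ha hr)
  rcases im_inv_ofReal_add_nonneg_or_nonpos a with h | h
  · exact integrableOn_Ioi_deriv_of_nonneg' hderiv (fun r _ => h r) (tendsto_arg_ofReal_add a)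
  · exact integrableOn_Ioi_deriv_of_nonpos' hderiv (fun r _ => h r) (tendsto_arg_ofReal_add a)

theorem integral_im_inv_ofReal_add (ha : a ∈ slitPlane) :
    ∫ r in Ioi (0 : ℝ), ((r + a : ℂ)⁻¹).im = -arg a := by
  have hderiv (r : ℝ) (hr : r ∈ Ici 0) :=
    hasDerivAt_arg_ofReal_add (ofReal_add_mem_slitPlane ha hr)
  rw [integral_Ioi_of_hasDerivAt_of_tendsto' hderiv (integrableOn_im_inv_ofReal_add ha)
    (tendsto_arg_ofReal_add a), ofReal_zero, zero_add, zero_sub]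

theorem integral_abs_im_inv_ofReal_add (ha : a ∈ slitPlane) :
    ∫ r in Ioi (0 : ℝ), |((r + a : ℂ)⁻¹).im| = |arg a| := by
  rw [← abs_neg (arg a), ← integral_im_inv_ofReal_add ha]
  rcases im_inv_ofReal_add_nonneg_or_nonpos a with h | h
  · rw [abs_of_nonneg (integral_nonneg h)]
    simp only [abs_of_nonneg (h _)]
  · rw [abs_of_nonpos (integral_nonpos h), ← integral_neg]
    simp only [abs_of_nonpos (h _)]

end RayIntegral

section AngleWedge

/-- The complex number `L` with `dφ(p, q) = (2π)⁻¹ Im (L dp)` as a form in `p`, where `φ` denotes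
the angle function. -/
noncomputable def angleLogDeriv (p q : ℂ) : ℂ :=
  (p - q)⁻¹ + (p - conj q)⁻¹

/-- The density of the form `dφ(p, q₁) ∧ dφ(p, q₂)` in `p` with respect to the area form. -/
noncomputable def angleWedge (p q₁ q₂ : ℂ) : ℝ :=
  ((2 * π) ^ 2)⁻¹ * (angleLogDeriv p q₁ * conj (angleLogDeriv p q₂)).im

theorem measurable_angleWedge {X : Type*} [MeasurableSpace X] {p q₁ q₂ : X → ℂ}
    (hp : Measurable p) (hq₁ : Measurable q₁) (hq₂ : Measurable q₂) :
    Measurable fun x => angleWedge (p x) (q₁ x) (q₂ x) := by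
  have hconj := continuous_conj.measurable
  have hL {q : X → ℂ} (hq : Measurable q) : Measurable fun x => angleLogDeriv (p x) (q x) :=
    (hp.sub hq).inv.add (hp.sub (hconj.comp hq)).inv
  exact (measurable_im.comp ((hL hq₁).mul (hconj.comp (hL hq₂)))).const_mul _

theorem mul_angleWedge_polarCoord_symm (q : ℂ) {r : ℝ} (hr : r ≠ 0) (α : ℝ) :
    r * angleWedge (Complex.polarCoord.symm (r, α)) 0 q =
      -(2 * π ^ 2)⁻¹ * (((r + -(q * exp (-(α * I))) : ℂ)⁻¹).im +
        ((r + -(conj q * exp (-(α * I))) : ℂ)⁻¹).im) := by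
  have : (r : ℂ) ≠ 0 := ofReal_ne_zero.2 hr
  have hpolar : Complex.polarCoord.symm (r, α) = r * exp (α * I) := by
    rw [Complex.polarCoord_symm_apply, exp_mul_I, ofReal_cos, ofReal_sin]
  have hinv (w : ℂ) : (r + -(w * exp (-(α * I))) : ℂ)⁻¹ =
      exp (α * I) * (r * exp (α * I) - w)⁻¹ := by
    have hfactor : r + -(w * exp (-(α * I))) = (exp (α * I))⁻¹ * (r * exp (α * I) - w) := by
      rw [exp_neg]
      field_simp [exp_ne_zero]
      ring
    rw [hfactor, mul_inv, inv_inv]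
  have hzero : conj (angleLogDeriv (r * exp (α * I)) 0) = 2 * (r : ℂ)⁻¹ * exp (α * I) := by
    have hconj : conj (exp (α * I)) = (exp (α * I))⁻¹ := by
      rw [← exp_conj, ← exp_neg]; simp
    simp only [angleLogDeriv, map_zero, sub_zero, map_add, map_inv₀, map_mul, conj_ofReal, hconj,
      mul_inv, inv_inv]
    ring
  have him : (angleLogDeriv (r * exp (α * I)) 0 * conj (angleLogDeriv (r * exp (α * I)) q)).im =
      -(2 * r⁻¹ * (exp (α * I) * angleLogDeriv (r * exp (α * I)) q).im) := by
    rw [← conj_conj (angleLogDeriv _ 0), ← map_mul, conj_im, hzero]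
    rw [show (2 * (r : ℂ)⁻¹ * exp (α * I) * angleLogDeriv (r * exp (α * I)) q) =
      ((2 * r⁻¹ : ℝ) : ℂ) * (exp (α * I) * angleLogDeriv (r * exp (α * I)) q) by push_cast; ring,
      im_ofReal_mul]
  rw [hpolar, angleWedge, him, hinv, hinv, ← add_im, ← mul_add, ← angleLogDeriv]
  field_simp

end AngleWedge

section Radial

theorem arg_ofReal_mul_exp {ρ θ : ℝ} (hρ : 0 < ρ) (hθ : θ ∈ Ioc (-π) π) :
    arg (ρ * exp (θ * I)) = θ := by
  rw [exp_mul_I, arg_mul_cos_add_sin_mul_I hρ hθ]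

variable {q : ℂ} {α : ℝ}

theorem arg_neg_mul_exp_neg (hq : q ≠ 0) (hq_im : 0 ≤ q.im) (hα : α ∈ Ioo 0 π)
    (hαq : α ≠ arg q) :
    arg (-(q * exp (-(α * I)))) = arg q - α + if arg q < α then π else -π := by
  have harg := arg_nonneg_iff.2 hq_im
  have hpolar (ε : ℝ) (hε : exp (ε * I) = -1) :
      -(q * exp (-(α * I))) = ‖q‖ * exp ((arg q - α + ε : ℝ) * I) := by
    conv_lhs => rw [← norm_mul_exp_arg_mul_I q]
    push_cast
    rw [add_mul, exp_add, hε, sub_mul, sub_eq_add_neg, exp_add]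
    ring
  split_ifs with h
  · rw [hpolar π exp_pi_mul_I, arg_ofReal_mul_exp (norm_pos_iff.2 hq)
      ⟨by linarith [hα.2], by linarith⟩]
  · have h' : α < arg q := lt_of_le_of_ne (not_lt.1 h) hαq
    rw [hpolar (-π) (by simp [exp_neg]), arg_ofReal_mul_exp (norm_pos_iff.2 hq)
      ⟨by linarith, by linarith [hα.1, arg_le_pi q, Real.pi_pos]⟩]

theorem arg_neg_conj_mul_exp_neg (hq : q ≠ 0) (hq_im : 0 ≤ q.im) (hα : α ∈ Ioo 0 π) :
    arg (-(conj q * exp (-(α * I)))) = π - arg q - α := by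
  have harg := arg_nonneg_iff.2 hq_im
  have hpolar : -(conj q * exp (-(α * I))) = ‖q‖ * exp ((π - arg q - α : ℝ) * I) := by
    conv_lhs => rw [← norm_mul_exp_arg_mul_I q, map_mul, conj_ofReal, ← exp_conj, map_mul,
      conj_ofReal, conj_I]
    push_cast
    rw [sub_mul, sub_mul, sub_eq_add_neg, sub_eq_add_neg, exp_add, exp_add, exp_pi_mul_I]
    ring_nf
  rw [hpolar, arg_ofReal_mul_exp (norm_pos_iff.2 hq)
    ⟨by linarith [hα.2, arg_le_pi q], by linarith [hα.1]⟩]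

theorem neg_mul_exp_neg_mem_slitPlane (hq : q ≠ 0) (hq_im : 0 ≤ q.im) (hα : α ∈ Ioo 0 π)
    (hαq : α ≠ arg q) : -(q * exp (-(α * I))) ∈ slitPlane := by
  refine mem_slitPlane_iff_arg.2 ⟨?_, neg_ne_zero.2 (mul_ne_zero hq (exp_ne_zero _))⟩
  rw [arg_neg_mul_exp_neg hq hq_im hα hαq]
  split_ifs with h
  · linarith
  · linarith [hα.1, arg_le_pi q, Real.pi_pos]

theorem neg_conj_mul_exp_neg_mem_slitPlane (hq : q ≠ 0) (hq_im : 0 ≤ q.im) (hα : α ∈ Ioo 0 π) :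
    -(conj q * exp (-(α * I))) ∈ slitPlane := by
  have hconj : conj q ≠ 0 := (map_ne_zero _).2 hq
  refine mem_slitPlane_iff_arg.2 ⟨?_, neg_ne_zero.2 (mul_ne_zero hconj (exp_ne_zero _))⟩
  rw [arg_neg_conj_mul_exp_neg hq hq_im hα]
  linarith [hα.1, arg_nonneg_iff.2 hq_im]

theorem integrableOn_mul_angleWedge (hq : q ≠ 0) (hq_im : 0 ≤ q.im) (hα : α ∈ Ioo 0 π)
    (hαq : α ≠ arg q) :
    IntegrableOn (fun r => r * angleWedge (Complex.polarCoord.symm (r, α)) 0 q) (Ioi 0) := by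
  refine IntegrableOn.congr_fun ?_
    (fun r hr => (mul_angleWedge_polarCoord_symm q (ne_of_gt hr) α).symm) measurableSet_Ioi
  exact ((integrableOn_im_inv_ofReal_add (neg_mul_exp_neg_mem_slitPlane hq hq_im hα hαq)).add
    (integrableOn_im_inv_ofReal_add
      (neg_conj_mul_exp_neg_mem_slitPlane hq hq_im hα))).const_mul _

theorem integral_mul_angleWedge (hq : q ≠ 0) (hq_im : 0 ≤ q.im) (hα : α ∈ Ioo 0 π)
    (hαq : α ≠ arg q) :
    ∫ r in Ioi (0 : ℝ), r * angleWedge (Complex.polarCoord.symm (r, α)) 0 q =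
      π⁻¹ * ((if arg q < α then 1 else 0) - α / π) := by
  have h₁ := neg_mul_exp_neg_mem_slitPlane hq hq_im hα hαq
  have h₂ := neg_conj_mul_exp_neg_mem_slitPlane hq hq_im hα
  rw [setIntegral_congr_fun measurableSet_Ioi fun r hr =>
      mul_angleWedge_polarCoord_symm q (ne_of_gt hr) α,
    integral_const_mul,
    integral_add (integrableOn_im_inv_ofReal_add h₁) (integrableOn_im_inv_ofReal_add h₂),
    integral_im_inv_ofReal_add h₁, integral_im_inv_ofReal_add h₂,
    arg_neg_mul_exp_neg hq hq_im hα hαq, arg_neg_conj_mul_exp_neg hq hq_im hα]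
  split_ifs <;> field_simp <;> ring

theorem integral_abs_mul_angleWedge_le (hq : q ≠ 0) (hq_im : 0 ≤ q.im) (hα : α ∈ Ioo 0 π)
    (hαq : α ≠ arg q) :
    ∫ r in Ioi (0 : ℝ), |r * angleWedge (Complex.polarCoord.symm (r, α)) 0 q| ≤ π⁻¹ := by
  set a₁ := -(q * exp (-(α * I)))
  set a₂ := -(conj q * exp (-(α * I)))
  have h₁ : a₁ ∈ slitPlane := neg_mul_exp_neg_mem_slitPlane hq hq_im hα hαq
  have h₂ : a₂ ∈ slitPlane := neg_conj_mul_exp_neg_mem_slitPlane hq hq_im hα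
  have hint₁ := (integrableOn_im_inv_ofReal_add h₁).abs
  have hint₂ := (integrableOn_im_inv_ofReal_add h₂).abs
  calc ∫ r in Ioi (0 : ℝ), |r * angleWedge (Complex.polarCoord.symm (r, α)) 0 q|
      ≤ ∫ r in Ioi (0 : ℝ), (2 * π ^ 2)⁻¹ * (|((r + a₁)⁻¹).im| + |((r + a₂)⁻¹).im|) := by
        refine setIntegral_mono_on (integrableOn_mul_angleWedge hq hq_im hα hαq).abs
          ((hint₁.add hint₂).const_mul _) measurableSet_Ioi fun r hr => ?_
        rw [mul_angleWedge_polarCoord_symm q (ne_of_gt hr) α, abs_mul, abs_neg,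
          abs_of_pos (by positivity : 0 < (2 * π ^ 2)⁻¹)]
        gcongr
        exact abs_add_le _ _
    _ = (2 * π ^ 2)⁻¹ * (|arg a₁| + |arg a₂|) := by
        rw [integral_const_mul, integral_add hint₁ hint₂, integral_abs_im_inv_ofReal_add h₁,
          integral_abs_im_inv_ofReal_add h₂]
    _ ≤ (2 * π ^ 2)⁻¹ * (π + π) := by
        gcongr <;> exact abs_arg_le_pi _
    _ = π⁻¹ := by
        field_simp
        ring

end Radial

section PolarCoordinates

/-- Lebesgue measure on the upper half plane. -/
noncomputable abbrev halfPlaneMeasure : Measure ℂ :=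
  volume.restrict upperHalfPlaneSet

theorem polarCoord_symm_preimage_upperHalfPlaneSet_inter_target :
    Complex.polarCoord.symm ⁻¹' upperHalfPlaneSet ∩ Complex.polarCoord.target =
      Ioi 0 ×ˢ Ioo 0 π := by
  ext ⟨r, α⟩
  have him : (Complex.polarCoord.symm (r, α)).im = r * Real.sin α := by
    simp [-ofReal_cos, -ofReal_sin]
  simp only [Complex.polarCoord_target, mem_inter_iff, mem_preimage, mem_prod, mem_ofPred_eq, him,
    mem_Ioi, mem_Ioo]
  constructor
  · rintro ⟨hsin, hr, hα, hα'⟩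
    refine ⟨hr, ?_, hα'⟩
    by_contra! hneg
    exact (pos_of_mul_pos_right hsin hr.le).not_ge
      (Real.sin_nonpos_of_nonpos_of_neg_pi_le hneg hα.le)
  · rintro ⟨hr, hα, hα'⟩
    exact ⟨mul_pos hr (Real.sin_pos_of_pos_of_lt_pi hα hα'), hr, by linarith, hα'⟩

theorem measurable_polarCoord_symm : Measurable Complex.polarCoord.symm := by
  rw [show ⇑Complex.polarCoord.symm = _ from funext Complex.polarCoord_symm_apply]
  fun_prop

theorem measurePreserving_polarCoord_symm :
    MeasurePreserving Complex.polarCoord.symm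
      (((volume.restrict (Ioi 0)).withDensity ENNReal.ofReal).prod (volume.restrict (Ioo 0 π)))
      halfPlaneMeasure := by
  refine ⟨measurable_polarCoord_symm, Measure.ext_of_lintegral _ fun f hf => ?_⟩
  have hℍ : MeasurableSet upperHalfPlaneSet :=
    isOpen_upperHalfPlaneSet.measurableSet
  have hf' : Measurable fun p => f (Complex.polarCoord.symm p) := hf.comp measurable_polarCoord_symm
  rw [lintegral_map hf measurable_polarCoord_symm, prod_withDensity_left ENNReal.measurable_ofReal,
    Measure.prod_restrict, ← Measure.volume_eq_prod,
    lintegral_withDensity_eq_lintegral_mul _ (by fun_prop) hf',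
    ← lintegral_indicator hℍ, ← Complex.lintegral_comp_polarCoord_symm,
    ← polarCoord_symm_preimage_upperHalfPlaneSet_inter_target,
    ← setLIntegral_indicator (measurable_polarCoord_symm hℍ)]
  refine lintegral_congr fun p => ?_
  by_cases hp : Complex.polarCoord.symm p ∈ upperHalfPlaneSet
  · rw [indicator_of_mem (mem_preimage.2 hp), indicator_of_mem hp]
    rfl
  · rw [indicator_of_notMem (mt mem_preimage.1 hp), indicator_of_notMem hp, smul_zero]

theorem lintegral_halfPlaneMeasure_eq_polar {f : ℂ → ENNReal} (hf : Measurable f) :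
    ∫⁻ z, f z ∂halfPlaneMeasure =
      ∫⁻ α in Ioo 0 π, ∫⁻ r in Ioi 0, ENNReal.ofReal r * f (Complex.polarCoord.symm (r, α)) := by
  have hf' : Measurable fun p => f (Complex.polarCoord.symm p) := hf.comp measurable_polarCoord_symm
  rw [← measurePreserving_polarCoord_symm.lintegral_comp hf, lintegral_prod_symm' _ hf']
  refine lintegral_congr fun α => ?_
  exact lintegral_withDensity_eq_lintegral_mul _ ENNReal.measurable_ofReal
    (hf'.comp measurable_prodMk_right)

theorem integral_halfPlaneMeasure_eq_polar {E : Type*} [NormedAddCommGroup E] [NormedSpace ℝ E]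
    {f : ℂ → E} (hf : Integrable f halfPlaneMeasure) :
    ∫ z, f z ∂halfPlaneMeasure =
      ∫ α in Ioo 0 π, ∫ r in Ioi (0 : ℝ), r • f (Complex.polarCoord.symm (r, α)) := by
  have hint := (measurePreserving_polarCoord_symm.integrable_comp hf.aestronglyMeasurable).2 hf
  rw [← measurePreserving_polarCoord_symm.map_eq] at hf ⊢
  rw [integral_map measurable_polarCoord_symm.aemeasurable hf.aestronglyMeasurable]
  refine (integral_prod_symm _ hint).trans ?_
  refine integral_congr_ae (.of_forall fun α => ?_)
  refine (integral_withDensity_eq_integral_toReal_smul ENNReal.measurable_ofReal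
    (.of_forall fun _ => ENNReal.ofReal_lt_top) _).trans ?_
  exact setIntegral_congr_fun measurableSet_Ioi fun r hr => by
    rw [ENNReal.toReal_ofReal (le_of_lt hr), Function.comp_apply]

theorem measurable_angleWedge_left (q₁ q₂ : ℂ) : Measurable fun z => angleWedge z q₁ q₂ :=
  measurable_angleWedge measurable_id measurable_const measurable_const

theorem lintegral_enorm_angleWedge_zero_le {q : ℂ} (hq : q ≠ 0) (hq_im : 0 ≤ q.im) :
    ∫⁻ z, ‖angleWedge z 0 q‖ₑ ∂halfPlaneMeasure ≤ 1 := by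
  rw [lintegral_halfPlaneMeasure_eq_polar (measurable_angleWedge_left 0 q).enorm]
  calc ∫⁻ α in Ioo 0 π, ∫⁻ r in Ioi 0,
        ENNReal.ofReal r * ‖angleWedge (Complex.polarCoord.symm (r, α)) 0 q‖ₑ
      ≤ ∫⁻ _ in Ioo 0 π, ENNReal.ofReal π⁻¹ := by
        refine lintegral_mono_ae ?_
        filter_upwards [ae_restrict_of_ae (Measure.ae_ne volume (arg q)),
          ae_restrict_mem measurableSet_Ioo] with α hαq hα
        calc ∫⁻ r in Ioi 0, ENNReal.ofReal r * ‖angleWedge (Complex.polarCoord.symm (r, α)) 0 q‖ₑ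
            = ∫⁻ r in Ioi 0, ‖r * angleWedge (Complex.polarCoord.symm (r, α)) 0 q‖ₑ :=
              setLIntegral_congr_fun measurableSet_Ioi fun r hr => by
                rw [enorm_mul, Real.enorm_of_nonneg (le_of_lt hr)]
          _ = ENNReal.ofReal
                (∫ r in Ioi 0, ‖r * angleWedge (Complex.polarCoord.symm (r, α)) 0 q‖) :=
              (ofReal_integral_norm_eq_lintegral_enorm
                (integrableOn_mul_angleWedge hq hq_im hα hαq)).symm
          _ ≤ ENNReal.ofReal π⁻¹ :=
              ENNReal.ofReal_le_ofReal (integral_abs_mul_angleWedge_le hq hq_im hα hαq)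
    _ = 1 := by
        rw [setLIntegral_const, Real.volume_Ioo, ← ENNReal.ofReal_mul (by positivity), sub_zero,
          inv_mul_cancel₀ Real.pi_ne_zero, ENNReal.ofReal_one]

theorem integrable_angleWedge_zero {q : ℂ} (hq : q ≠ 0) (hq_im : 0 ≤ q.im) :
    Integrable (fun z => angleWedge z 0 q) halfPlaneMeasure :=
  ⟨(measurable_angleWedge_left 0 q).aestronglyMeasurable,
    (lintegral_enorm_angleWedge_zero_le hq hq_im).trans_lt ENNReal.one_lt_top⟩

theorem arg_div_pi_mem_Icc {z : ℂ} (hz : 0 ≤ z.im) : arg z / π ∈ Icc 0 1 :=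
  ⟨div_nonneg (arg_nonneg_iff.2 hz) Real.pi_pos.le, (div_le_one Real.pi_pos).2 (arg_le_pi z)⟩

theorem integrable_angleWedge_zero_mul_comp_arg {q : ℂ} (hq : q ≠ 0) (hq_im : 0 ≤ q.im) {G : ℝ → ℝ}
    (hG : Continuous G) :
    Integrable (fun z => angleWedge z 0 q * G (arg z / π)) halfPlaneMeasure := by
  obtain ⟨C, hC⟩ := (isCompact_Icc (a := (0 : ℝ)) (b := 1)).exists_bound_of_continuousOn
    hG.continuousOn
  refine (integrable_angleWedge_zero hq hq_im).mul_bdd (c := C)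
    (hG.measurable.comp (measurable_arg.div_const π)).aestronglyMeasurable ?_
  filter_upwards [ae_restrict_mem isOpen_upperHalfPlaneSet.measurableSet] with z hz
  exact hC _ (arg_div_pi_mem_Icc (le_of_lt hz))

theorem arg_polarCoord_symm {r α : ℝ} (hr : 0 < r) (hα : α ∈ Ioc (-π) π) :
    arg (Complex.polarCoord.symm (r, α)) = α := by
  rw [Complex.polarCoord_symm_apply, ofReal_cos, ofReal_sin, arg_mul_cos_add_sin_mul_I hr hα]

theorem integral_angleWedge_zero_mul_comp_arg {q : ℂ} (hq : q ≠ 0) (hq_im : 0 ≤ q.im) {G : ℝ → ℝ}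
    (hG : Continuous G) :
    ∫ z, angleWedge z 0 q * G (arg z / π) ∂halfPlaneMeasure =
      ∫ s in (0 : ℝ)..1, ((Ioi (arg q / π)).indicator 1 s - s) * G s := by
  calc ∫ z, angleWedge z 0 q * G (arg z / π) ∂halfPlaneMeasure
      = ∫ α in Ioo 0 π, π⁻¹ *
          (((Ioi (arg q / π)).indicator 1 (α / π) - α / π) * G (α / π)) := by
        rw [integral_halfPlaneMeasure_eq_polar
          (integrable_angleWedge_zero_mul_comp_arg hq hq_im hG)]
        refine integral_congr_ae ?_
        filter_upwards [ae_restrict_of_ae (Measure.ae_ne volume (arg q)),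
          ae_restrict_mem measurableSet_Ioo] with α hαq hα
        calc ∫ r in Ioi (0 : ℝ), r • (angleWedge (Complex.polarCoord.symm (r, α)) 0 q *
              G (arg (Complex.polarCoord.symm (r, α)) / π))
            = ∫ r in Ioi 0, r * angleWedge (Complex.polarCoord.symm (r, α)) 0 q * G (α / π) :=
              setIntegral_congr_fun measurableSet_Ioi fun r hr => by
                rw [arg_polarCoord_symm hr ⟨by linarith [hα.1, Real.pi_pos], hα.2.le⟩,
                  smul_eq_mul, mul_assoc]
          _ = _ := by
              rw [integral_mul_const, integral_mul_angleWedge hq hq_im hα hαq, mul_assoc]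
              simp [indicator_apply, div_lt_div_iff_of_pos_right Real.pi_pos]
    _ = ∫ s in (0 : ℝ)..1, ((Ioi (arg q / π)).indicator 1 s - s) * G s := by
        rw [integral_const_mul, ← integral_Ioc_eq_integral_Ioo,
          ← intervalIntegral.integral_of_le Real.pi_pos.le,
          intervalIntegral.integral_comp_div
            (fun s => ((Ioi (arg q / π)).indicator 1 s - s) * G s) Real.pi_ne_zero]
        simp

end PolarCoordinates

section IteratedIntegral

theorem integral_integral_eq_sub {G : ℝ → ℝ} (hG : Continuous G) (θ : ℝ) :
    ∫ lam in (0 : ℝ)..1, ∫ s in θ..lam, G s =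
      (∫ s in θ..1, G s) - ∫ s in (0 : ℝ)..1, s * G s := by
  have hderiv : ∀ x ∈ uIcc (0 : ℝ) 1, HasDerivAt (fun x => ∫ s in θ..x, G s) (G x) x :=
    fun x _ => hG.integral_hasStrictDerivAt θ x |>.hasDerivAt
  have hparts := intervalIntegral.integral_mul_deriv_eq_deriv_mul (a := (0 : ℝ)) (b := 1)
    (u := fun x => x) (fun x _ => hasDerivAt_id x) hderiv
    (continuous_const.intervalIntegrable _ _) (hG.intervalIntegrable _ _)
  simp only [one_mul, zero_mul, sub_zero] at hparts
  rw [hparts, sub_sub_cancel]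

theorem integral_indicator_Ioi_sub_id_mul {G : ℝ → ℝ} (hG : Continuous G) {θ : ℝ}
    (hθ : θ ∈ Icc 0 1) :
    ∫ s in (0 : ℝ)..1, ((Ioi θ).indicator 1 s - s) * G s =
      ∫ lam in (0 : ℝ)..1, ∫ s in θ..lam, G s := by
  have hind (s : ℝ) : ((Ioi θ).indicator 1 s - s) * G s = (Ioi θ).indicator G s - s * G s := by
    by_cases hs : s ∈ Ioi θ <;> simp [hs, sub_mul]
  have hint : IntervalIntegrable ((Ioi θ).indicator G) volume 0 1 := by
    rw [intervalIntegrable_iff]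
    exact (hG.intervalIntegrable 0 1).def'.indicator measurableSet_Ioi
  have hint' : IntervalIntegrable (fun s => s * G s) volume 0 1 :=
    (continuous_id.mul hG).intervalIntegrable 0 1
  simp only [hind]
  rw [integral_integral_eq_sub hG, intervalIntegral.integral_sub hint hint',
    intervalIntegral.integral_of_le zero_le_one, setIntegral_indicator measurableSet_Ioi,
    intervalIntegral.integral_of_le hθ.2, Ioc_inter_Ioi, max_eq_right hθ.1]

end IteratedIntegral

section Grafting

/-- Splits a configuration of the vertices of a graft into the position of the new root and the
configurations of the grafted trees. -/
def graftConfigEquiv (X : Type*) [MeasurableSpace X] {ι : Type*} (V : ι → Type*) :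
    (Option (Σ i, V i) → X) ≃ᵐ X × (∀ i, V i → X) where
  toFun z := (z none, fun i v => z (some ⟨i, v⟩))
  invFun p o := o.elim p.1 fun s => p.2 s.1 s.2
  left_inv z := by
    ext o
    rcases o with _ | ⟨i, v⟩ <;> rfl
  right_inv _ := rfl
  measurable_toFun := by
    refine (measurable_pi_apply none).prodMk ?_
    exact measurable_pi_lambda _ fun i => measurable_pi_lambda _ fun v => measurable_pi_apply _
  measurable_invFun := by
    refine measurable_pi_lambda _ ?_
    rintro (_ | ⟨i, v⟩)
    · exact measurable_fst
    · exact (measurable_pi_apply v).comp ((measurable_pi_apply i).comp measurable_snd)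

theorem measurePreserving_graftConfigEquiv_symm {X : Type*} [MeasurableSpace X] {ι : Type*}
    [Fintype ι] (V : ι → Type*) [∀ i, Fintype (V i)] (μ : Measure X) [SigmaFinite μ] :
    MeasurePreserving (graftConfigEquiv X V).symm
      (μ.prod (Measure.pi fun i => Measure.pi fun _ : V i => μ)) (Measure.pi fun _ => μ) := by
  refine ⟨(graftConfigEquiv X V).symm.measurable, (Measure.pi_eq fun s _ => ?_).symm⟩
  have hpreimage : (graftConfigEquiv X V).symm ⁻¹' univ.pi s =
      s none ×ˢ univ.pi fun i => univ.pi fun v => s (some ⟨i, v⟩) := by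
    ext p
    simp only [mem_preimage, mem_univ_pi, mem_prod]
    refine ⟨fun h => ⟨h none, fun i v => h (some ⟨i, v⟩)⟩, ?_⟩
    rintro ⟨h, h'⟩ (_ | ⟨i, v⟩)
    · exact h
    · exact h' i v
  rw [(graftConfigEquiv X V).symm.map_apply, hpreimage, Measure.prod_prod, Measure.pi_pi,
    Fintype.prod_option, Fintype.prod_sigma]
  simp only [Measure.pi_pi]

theorem lintegral_enorm_fintype_prod_eq_prod {ι : Type*} [Fintype ι] {X : ι → Type*}
    [∀ i, MeasurableSpace (X i)] {μ : ∀ i, Measure (X i)} [∀ i, SigmaFinite (μ i)]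
    {f : ∀ i, X i → ℝ} (hf : ∀ i, Integrable (f i) (μ i)) :
    ∫⁻ x, ‖∏ i, f i (x i)‖ₑ ∂Measure.pi μ = ∏ i, ∫⁻ x, ‖f i x‖ₑ ∂μ i := by
  simp only [← ofReal_integral_norm_eq_lintegral_enorm (Integrable.fintype_prod_dep hf),
    ← ofReal_integral_norm_eq_lintegral_enorm (hf _), norm_prod]
  rw [integral_fintype_prod_eq_prod fun i x => ‖f i x‖,
    ENNReal.ofReal_prod_of_nonneg fun i _ => integral_nonneg fun _ => norm_nonneg _]

theorem ne_zero_of_im_pos {p : ℂ} (hp : 0 < p.im) : p ≠ 0 := by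
  rintro rfl
  exact hp.ne' zero_im

end Grafting

namespace RootedTreeOn

variable {V V' : Type*} [Fintype V] [Fintype V']

/-- The density of the angle form of `t` when the first edges of all vertices end at `0`
and the second edge of the root ends at `q`. -/
noncomputable def density (t : RootedTreeOn V) (q : ℂ) (z : V → ℂ) : ℝ :=
  ∏ v, angleWedge (z v) 0 ((t.parent v).elim q z)

theorem measurable_density (t : RootedTreeOn V) (q : ℂ) : Measurable (t.density q) := by
  refine Finset.measurable_fun_prod _ fun v _ =>
    measurable_angleWedge (measurable_pi_apply v) measurable_const ?_
  cases t.parent v with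
  | none => exact measurable_const
  | some w => exact measurable_pi_apply w

theorem Iso.density_comp {t : RootedTreeOn V} {t' : RootedTreeOn V'} (σ : t.Iso t') (q : ℂ)
    (z : V' → ℂ) : t.density q (z ∘ σ.toEquiv) = t'.density q z := by
  refine Fintype.prod_equiv σ.toEquiv _ _ fun v => ?_
  have hv : t'.parent (σ.toEquiv v) = (t.parent v).map σ.toEquiv := σ.map_parent v
  rw [hv, Function.comp_apply]
  cases t.parent v <;> rfl

theorem Iso.integrable_density_iff {t : RootedTreeOn V} {t' : RootedTreeOn V'} (σ : t.Iso t')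
    (q : ℂ) (μ : Measure ℂ) [SigmaFinite μ] :
    Integrable (t.density q) (Measure.pi fun _ => μ) ↔
      Integrable (t'.density q) (Measure.pi fun _ => μ) := by
  have hpres := measurePreserving_arrowCongr' (fun _ => μ) (fun _ => μ) σ.toEquiv.symm
    (.refl ℂ) fun _ => .id μ
  rw [← hpres.integrable_comp_emb (MeasurableEquiv.measurableEmbedding _)]
  exact iff_of_eq (congrArg (Integrable · _) (funext (σ.density_comp q)))

theorem Iso.integral_density_eq {t : RootedTreeOn V} {t' : RootedTreeOn V'} (σ : t.Iso t')
    (q : ℂ) (μ : Measure ℂ) [SigmaFinite μ] :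
    ∫ z, t.density q z ∂Measure.pi (fun _ => μ) = ∫ z, t'.density q z ∂Measure.pi fun _ => μ := by
  have hpres := measurePreserving_arrowCongr' (fun _ => μ) (fun _ => μ) σ.toEquiv.symm
    (.refl ℂ) fun _ => .id μ
  rw [← hpres.integral_comp']
  exact integral_congr_ae (.of_forall (σ.density_comp q))

theorem density_graft_graftConfigEquiv_symm {ι : Type*} [Fintype ι] {W : ι → Type*}
    [∀ i, Fintype (W i)] (ts : ∀ i, RootedTreeOn (W i)) (q p : ℂ) (z : ∀ i, W i → ℂ) :
    (graft ts).density q ((graftConfigEquiv ℂ W).symm (p, z)) =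
      angleWedge p 0 q * ∏ i, (ts i).density p (z i) := by
  rw [density, Fintype.prod_option, Fintype.prod_sigma]
  refine congrArg₂ _ rfl (Finset.prod_congr rfl fun i _ => Finset.prod_congr rfl fun v _ => ?_)
  simp only [graft, Option.elim_some]
  cases (ts i).parent v <;> rfl

theorem density_single (q : ℂ) (z : Unit → ℂ) : single.density q z = angleWedge (z ()) 0 q := by
  simp [density, single]

theorem lintegral_enorm_density_single_le {q : ℂ} (hq : q ≠ 0) (hq_im : 0 ≤ q.im) :
    ∫⁻ z, ‖single.density q z‖ₑ ∂Measure.pi (fun _ => halfPlaneMeasure) ≤ 1 := by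
  have hpres := measurePreserving_funUnique halfPlaneMeasure Unit
  simp only [density_single]
  exact (hpres.lintegral_comp_emb (MeasurableEquiv.measurableEmbedding _)
    fun z => ‖angleWedge z 0 q‖ₑ).trans_le (lintegral_enorm_angleWedge_zero_le hq hq_im)

theorem integral_density_single {q : ℂ} (hq : q ≠ 0) (hq_im : 0 ≤ q.im) :
    ∫ z, single.density q z ∂Measure.pi (fun _ => halfPlaneMeasure) = 1 / 2 - arg q / π := by
  have hpres := measurePreserving_funUnique halfPlaneMeasure Unit
  have hG : Continuous fun _ : ℝ => (1 : ℝ) := continuous_const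
  simp only [density_single]
  calc ∫ z, angleWedge (z ()) 0 q ∂Measure.pi (fun _ : Unit => halfPlaneMeasure)
      = ∫ z, angleWedge z 0 q * 1 ∂halfPlaneMeasure := by
        simp only [mul_one]
        exact hpres.integral_comp' fun z => angleWedge z 0 q
    _ = ∫ lam in (0 : ℝ)..1, ∫ _ in (arg q / π)..lam, (1 : ℝ) := by
        rw [integral_angleWedge_zero_mul_comp_arg hq hq_im hG,
          integral_indicator_Ioi_sub_id_mul hG (arg_div_pi_mem_Icc hq_im)]
    _ = 1 / 2 - arg q / π := by simp

variable {ι : Type*} [Fintype ι] {W : ι → Type*} [∀ i, Fintype (W i)]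
  {ts : ∀ i, RootedTreeOn (W i)}

theorem integrable_density_of_lintegral_le {t : RootedTreeOn V} {q : ℂ} {μ : Measure (V → ℂ)}
    (h : ∫⁻ z, ‖t.density q z‖ₑ ∂μ ≤ 1) : Integrable (t.density q) μ :=
  ⟨(t.measurable_density q).aestronglyMeasurable, h.trans_lt ENNReal.one_lt_top⟩

theorem lintegral_enorm_density_graft_le
    (hts : ∀ i p, 0 < p.im →
      ∫⁻ z, ‖(ts i).density p z‖ₑ ∂Measure.pi (fun _ => halfPlaneMeasure) ≤ 1)
    {q : ℂ} (hq : q ≠ 0) (hq_im : 0 ≤ q.im) :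
    ∫⁻ z, ‖(graft ts).density q z‖ₑ ∂Measure.pi (fun _ => halfPlaneMeasure) ≤ 1 := by
  have hpres := measurePreserving_graftConfigEquiv_symm W halfPlaneMeasure
  have hmeas : Measurable fun p => (graft ts).density q ((graftConfigEquiv ℂ W).symm p) :=
    ((graft ts).measurable_density q).comp hpres.measurable
  rw [← hpres.lintegral_comp ((graft ts).measurable_density q).enorm,
    lintegral_prod _ hmeas.enorm.aemeasurable]
  refine (lintegral_mono_ae ?_).trans (lintegral_enorm_angleWedge_zero_le hq hq_im)
  filter_upwards [ae_restrict_mem isOpen_upperHalfPlaneSet.measurableSet] with p hp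
  simp only [density_graft_graftConfigEquiv_symm, enorm_mul]
  rw [lintegral_const_mul' _ _ enorm_ne_top,
    lintegral_enorm_fintype_prod_eq_prod fun i => integrable_density_of_lintegral_le (hts i p hp)]
  exact mul_le_of_le_one_right' (Finset.prod_le_one' fun i _ => hts i p hp)

theorem integral_density_graft {f : ι → ℝ → ℝ} (hf : ∀ i, Continuous (f i))
    (hts : ∀ i p, 0 < p.im →
      ∫ z, (ts i).density p z ∂Measure.pi (fun _ => halfPlaneMeasure) = f i (arg p / π))
    {q : ℂ} (hq : q ≠ 0) (hq_im : 0 ≤ q.im)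
    (hint : Integrable ((graft ts).density q) (Measure.pi fun _ => halfPlaneMeasure)) :
    ∫ z, (graft ts).density q z ∂Measure.pi (fun _ => halfPlaneMeasure) =
      ∫ lam in (0 : ℝ)..1, ∫ s in (arg q / π)..lam, ∏ i, f i s := by
  have hpres := measurePreserving_graftConfigEquiv_symm W halfPlaneMeasure
  have hint' := (hpres.integrable_comp hint.aestronglyMeasurable).2 hint
  have hG : Continuous fun s => ∏ i, f i s := continuous_finsetProd _ fun i _ => hf i
  simp only [Function.comp_def] at hint'
  rw [← hpres.integral_comp', integral_prod _ hint',
    ← integral_indicator_Ioi_sub_id_mul hG (arg_div_pi_mem_Icc hq_im),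
    ← integral_angleWedge_zero_mul_comp_arg hq hq_im hG]
  refine setIntegral_congr_fun isOpen_upperHalfPlaneSet.measurableSet fun p hp => ?_
  simp only [density_graft_graftConfigEquiv_symm]
  rw [integral_const_mul, integral_fintype_prod_eq_prod fun i z => (ts i).density p z]
  exact congrArg _ (Finset.prod_congr rfl fun i _ => hts i p hp)

end RootedTreeOn

namespace BracketTree

theorem continuous_I : ∀ e : BracketTree, Continuous e.I
  | .bullet => by
    simp only [I]
    fun_prop
  | .graft _ ts => by
    have hG : Continuous fun s => ∏ i, (ts i).I s :=
      continuous_finsetProd _ fun i _ => (ts i).continuous_I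
    simp only [I, integral_integral_eq_sub hG]
    simp only [intervalIntegral.integral_symm 1]
    exact (intervalIntegral.continuous_primitive hG.intervalIntegrable 1).neg.sub continuous_const

theorem lintegral_enorm_density_le : ∀ (e : BracketTree) {q : ℂ}, q ≠ 0 → 0 ≤ q.im →
    ∫⁻ z, ‖e.toRootedTree.density q z‖ₑ ∂Measure.pi (fun _ => halfPlaneMeasure) ≤ 1
  | .bullet, _, hq, hq_im => RootedTreeOn.lintegral_enorm_density_single_le hq hq_im
  | .graft _ ts, _, hq, hq_im =>
    RootedTreeOn.lintegral_enorm_density_graft_le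
      (fun i _ hp => (ts i).lintegral_enorm_density_le (ne_zero_of_im_pos hp) hp.le) hq hq_im

theorem integrable_density (e : BracketTree) {q : ℂ} (hq : q ≠ 0) (hq_im : 0 ≤ q.im) :
    Integrable (e.toRootedTree.density q) (Measure.pi fun _ => halfPlaneMeasure) :=
  RootedTreeOn.integrable_density_of_lintegral_le (e.lintegral_enorm_density_le hq hq_im)

theorem integral_density : ∀ (e : BracketTree) {q : ℂ}, q ≠ 0 → 0 ≤ q.im →
    ∫ z, e.toRootedTree.density q z ∂Measure.pi (fun _ => halfPlaneMeasure) = e.I (arg q / π)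
  | .bullet, _, hq, hq_im => RootedTreeOn.integral_density_single hq hq_im
  | .graft k ts, _, hq, hq_im =>
    RootedTreeOn.integral_density_graft (fun i => (ts i).continuous_I)
      (fun i _ hp => (ts i).integral_density (ne_zero_of_im_pos hp) hp.le) hq hq_im
      ((graft k ts).integrable_density hq hq_im)

end BracketTree

section BernoulliPolynomials

theorem integral_integral_bernoulliFun (k : ℕ) (θ : ℝ) :
    ∫ lam in (0 : ℝ)..1, ∫ s in θ..lam, bernoulliFun k s =
      -bernoulliFun (k + 1) θ / (k + 1) := by
  have hinner (lam : ℝ) : ∫ s in θ..lam, bernoulliFun k s =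
      bernoulliFun (k + 1) lam / (k + 1) - bernoulliFun (k + 1) θ / (k + 1) :=
    intervalIntegral.integral_eq_sub_of_hasDerivAt (fun x _ => antideriv_bernoulliFun k x)
      (intervalIntegrable_bernoulliFun _ _ _)
  simp only [hinner]
  rw [intervalIntegral.integral_sub ((intervalIntegrable_bernoulliFun _ _ _).div_const _)
      intervalIntegrable_const, intervalIntegral.integral_div,
    integral_bernoulliFun_eq_zero k.succ_ne_zero]
  simp [neg_div]

end BernoulliPolynomials

namespace BracketTree

theorem I_bullet (θ : ℝ) : bullet.I θ = -bernoulliFun 1 θ := by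
  rw [bernoulliFun_one, neg_sub]
  rfl

theorem I_graft_singleton (e : BracketTree) (θ : ℝ) :
    (graft 0 ![e]).I θ = ∫ lam in (0 : ℝ)..1, ∫ s in θ..lam, e.I s := by
  have hprod (s : ℝ) : ∏ i, (![e] i).I s = e.I s := Fin.prod_univ_one _
  simp only [I, ← hprod]

theorem I_graft_bullet (θ : ℝ) : (graft 0 ![bullet]).I θ = bernoulliFun 2 θ / 2 := by
  simp only [I_graft_singleton, I_bullet, intervalIntegral.integral_neg]
  rw [integral_integral_bernoulliFun]
  push_cast
  ring

theorem I_graft_graft_bullet (θ : ℝ) :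
    (graft 0 ![graft 0 ![bullet]]).I θ = -bernoulliFun 3 θ / 6 := by
  simp only [I_graft_singleton _ θ, I_graft_bullet, intervalIntegral.integral_div]
  rw [integral_integral_bernoulliFun]
  push_cast
  ring

theorem I_graft_bullet_bullet (θ : ℝ) :
    (graft 1 ![bullet, bullet]).I θ = -bernoulliFun 3 θ / 3 - bernoulliFun 1 θ / 12 := by
  have hprod (s : ℝ) :
      ∏ i, (![bullet, bullet] i).I s = bernoulliFun 2 s + bernoulliFun 0 s / 12 := by
    rw [Fin.prod_univ_two]
    change bullet.I s * bullet.I s = _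
    rw [I_bullet, bernoulliFun_zero, bernoulliFun_one, bernoulliFun_two]
    ring
  have hcont (k : ℕ) : Continuous fun lam : ℝ => ∫ s in θ..lam, bernoulliFun k s :=
    intervalIntegral.continuous_primitive (intervalIntegrable_bernoulliFun k) θ
  calc (graft 1 ![bullet, bullet]).I θ
      = ∫ lam in (0 : ℝ)..1, ∫ s in θ..lam, (bernoulliFun 2 s + bernoulliFun 0 s / 12) := by
        simp only [I, ← hprod]
    _ = ∫ lam in (0 : ℝ)..1,
          ((∫ s in θ..lam, bernoulliFun 2 s) + (∫ s in θ..lam, bernoulliFun 0 s) / 12) := by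
        simp only [← intervalIntegral.integral_div]
        exact intervalIntegral.integral_congr fun lam _ => intervalIntegral.integral_add
          (intervalIntegrable_bernoulliFun _ _ _)
          ((intervalIntegrable_bernoulliFun _ _ _).div_const _)
    _ = -bernoulliFun 3 θ / 3 - bernoulliFun 1 θ / 12 := by
        rw [intervalIntegral.integral_add ((hcont 2).intervalIntegrable _ _)
            (((hcont 0).div_const _).intervalIntegrable _ _), intervalIntegral.integral_div,
          integral_integral_bernoulliFun, integral_integral_bernoulliFun]
        norm_num
        ring

end BracketTree

section AngleDerivative

theorem angle_eq_fract_arg_mul (p q : ℂ) :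
    angle p q = Int.fract (arg (-((p - q) * (conj q - p))) / (2 * π)) := by
  have hconj : conj (q - conj p) = conj q - p := by rw [map_sub, conj_conj]
  rw [angle]
  rcases eq_or_ne (q - conj p) 0 with h | h
  · rw [h, ← hconj, h, map_zero, div_zero, mul_zero, neg_zero]
  · have hdiv : (q - p) / (q - conj p) =
        ((normSq (q - conj p))⁻¹ : ℝ) * -((p - q) * (conj q - p)) := by
      rw [div_eq_mul_inv, inv_def, hconj]
      ring
    rw [hdiv, arg_real_mul _ (inv_pos.2 (normSq_pos.2 h))]

theorem fract_arg_neg_div_two_pi {u : ℂ} (hu : u ∈ slitPlane) :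
    Int.fract (arg (-u) / (2 * π)) = (arg u + π) / (2 * π) := by
  obtain ⟨n, hn⟩ := Real.Angle.angle_eq_iff_two_pi_dvd_sub.1
    ((arg_neg_coe_angle (slitPlane_ne_zero hu)).trans (Real.Angle.coe_add _ _).symm)
  have hlt : arg u < π := (arg_le_pi u).lt_of_ne (mem_slitPlane_iff_arg.1 hu).1
  rw [Int.fract_eq_iff]
  refine ⟨div_nonneg (by linarith [neg_pi_lt_arg u]) Real.two_pi_pos.le, ?_, n, ?_⟩
  · rw [div_lt_one Real.two_pi_pos]
    linarith
  · rw [← sub_div, hn, mul_div_cancel_left₀ _ Real.two_pi_pos.ne']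

theorem sub_mul_conj_sub_mem_slitPlane {p q : ℂ} (hp : p.im ≠ 0) (h : p.re ≠ q.re) :
    (p - q) * (conj q - p) ∈ slitPlane := by
  have him : ((p - q) * (conj q - p)).im = -2 * p.im * (p.re - q.re) := by
    simp only [mul_im, sub_re, sub_im, conj_im, conj_re]
    ring
  rw [mem_slitPlane_iff, him]
  exact .inr (mul_ne_zero (mul_ne_zero (by norm_num) hp) (sub_ne_zero.2 h))

/-- The differential of the angle function at `(p, q)`. -/
noncomputable def angleDeriv (p q : ℂ) : ℂ × ℂ →L[ℝ] ℝ :=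
  (2 * π)⁻¹ • imCLM.comp ((p - q)⁻¹ • (.fst ℝ ℂ ℂ - .snd ℝ ℂ ℂ) +
    (p - conj q)⁻¹ • (.fst ℝ ℂ ℂ - (conjCLE : ℂ →L[ℝ] ℂ).comp (.snd ℝ ℂ ℂ)))

theorem angleDeriv_apply_zero (p q v : ℂ) :
    angleDeriv p q (v, 0) = (2 * π)⁻¹ * (angleLogDeriv p q * v).im := by
  rw [angleLogDeriv, add_mul]
  simp [angleDeriv, mul_add, -mul_im, -mul_inv_rev]

theorem hasFDerivAt_angle {p q : ℂ} (hp : p.im ≠ 0) (h : p.re ≠ q.re) :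
    HasFDerivAt (fun x : ℂ × ℂ => angle x.1 x.2) (angleDeriv p q) (p, q) := by
  have hslit := sub_mul_conj_sub_mem_slitPlane hp h
  let u : ℂ × ℂ → ℂ := fun x => (x.1 - x.2) * (conj x.2 - x.1)
  have hu : HasFDerivAt u _ (p, q) :=
    (hasFDerivAt_fst.sub hasFDerivAt_snd).mul
      (((conjCLE : ℂ →L[ℝ] ℂ).hasFDerivAt.comp (p, q) hasFDerivAt_snd).sub hasFDerivAt_fst)
  have hlog : HasFDerivAt log _ (u (p, q)) := (hasDerivAt_log hslit).complexToReal_fderiv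
  have harg := ((imCLM.hasFDerivAt.comp _ (hlog.comp _ hu)).add_const π).const_mul (2 * π)⁻¹
  refine (harg.congr_of_eventuallyEq ?_).congr_fderiv ?_
  · filter_upwards [hu.continuousAt.eventually_mem (isOpen_slitPlane.mem_nhds hslit)] with x hx
    rw [angle_eq_fract_arg_mul, fract_arg_neg_div_two_pi hx, div_eq_inv_mul, ← log_im]
    rfl
  · have hpq := left_ne_zero_of_mul (slitPlane_ne_zero hslit)
    have hqp := right_ne_zero_of_mul (slitPlane_ne_zero hslit)
    have hlogDeriv (v : ℂ × ℂ) : ((p - q) * (conj q - p))⁻¹ *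
        ((p - q) * (conj v.2 - v.1) + (conj q - p) * (v.1 - v.2)) =
        (p - q)⁻¹ * (v.1 - v.2) + (p - conj q)⁻¹ * (v.1 - conj v.2) := by
      rw [← neg_sub (conj q) p]
      field_simp
      ring
    exact ContinuousLinearMap.ext fun v =>
      congrArg (fun w : ℂ => (2 * π)⁻¹ * w.im) (hlogDeriv v)

end AngleDerivative

theorem det_eq_prod_det_submatrix_of_lt {V n α R : Type*} [Fintype V] [DecidableEq V] [Fintype n]
    [DecidableEq n] [CommRing R] [LinearOrder α] {M : Matrix (V × n) (V × n) R} (d : V → α)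
    (h : ∀ k l i j, M (k, i) (l, j) ≠ 0 → k ≠ l → d l < d k) :
    M.det = ∏ k, (M.submatrix (Prod.mk k) (Prod.mk k)).det := by
  let b (v : V) : (α ×ₗ Fin (Fintype.card V))ᵒᵈ :=
    OrderDual.toDual (toLex (d v, Fintype.equivFin V v))
  have hb : Function.Injective b := fun v w hvw =>
    (Fintype.equivFin V).injective (Prod.ext_iff.1 (toLex.injective
      (OrderDual.toDual.injective hvw))).2
  have hM : M.BlockTriangular fun x => b x.1 := fun x y hyx => by
    by_contra hxy
    have hlt : b x.1 < b y.1 :=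
      Prod.Lex.toLex_lt_toLex.2 (.inl (h x.1 y.1 x.2 y.2 hxy fun hne => hyx.ne' (congrArg b hne)))
    exact hlt.not_gt hyx
  have himage : Finset.univ.image (fun x : V × n => b x.1) ⊆ Finset.univ.image b := by
    simp only [Finset.image_subset_iff, Finset.mem_univ, Finset.mem_image_of_mem, forall_const,
      implies_true]
  rw [hM.det, Finset.prod_subset himage, Finset.prod_image fun _ _ _ _ hxy => hb hxy]
  · refine Finset.prod_congr rfl fun k _ => ?_
    let e : n ≃ {x : V × n // b x.1 = b k} :=
      { toFun i := ⟨(k, i), rfl⟩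
        invFun x := x.1.2
        left_inv _ := rfl
        right_inv := by
          rintro ⟨⟨l, i⟩, hl⟩
          obtain rfl := hb hl
          rfl }
    exact (Matrix.det_submatrix_equiv_self e _).symm
  · intro x _ hx
    have : IsEmpty {y : V × n // b y.1 = x} :=
      ⟨fun y => hx (Finset.mem_image.2 ⟨y, Finset.mem_univ _, y.2⟩)⟩
    exact Matrix.det_isEmpty

section EdgeAngle

variable {V : Type*}

/-- The derivative of `fun z => KontsevichGraph.position z s`. -/
noncomputable def positionDeriv : V ⊕ Fin 2 → (V → ℂ) →L[ℝ] ℂ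
  | Sum.inl k => .proj k
  | Sum.inr _ => 0

theorem position_eq_positionDeriv_add (z : V → ℂ) (s : V ⊕ Fin 2) :
    KontsevichGraph.position z s = positionDeriv s z + KontsevichGraph.position 0 s := by
  rcases s with k | j
  · exact (add_zero (z k)).symm
  · exact (zero_add _).symm

theorem hasFDerivAt_position [Finite V] (s : V ⊕ Fin 2) (z : V → ℂ) :
    HasFDerivAt (fun z => KontsevichGraph.position z s) (positionDeriv s) z := by
  have := Fintype.ofFinite V
  rw [funext fun z => position_eq_positionDeriv_add z s]
  exact (positionDeriv s).hasFDerivAt.add_const _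

theorem positionDeriv_single_of_ne [DecidableEq V] {s : V ⊕ Fin 2} {l : V} (hs : s ≠ Sum.inl l)
    (v : ℂ) : positionDeriv s (Pi.single l v) = 0 := by
  rcases s with k | j
  · exact Pi.single_eq_of_ne (M := fun _ : V => ℂ) (fun hkl => hs (congrArg Sum.inl hkl)) v
  · rfl

end EdgeAngle

namespace KontsevichGraph

variable {V : Type*} (Γ : KontsevichGraph V 2) {z : V → ℂ} {k : V} {i : Fin 2}

theorem hasFDerivAt_edgeAngle [Finite V] (hk : (z k).im ≠ 0)
    (h : (z k).re ≠ (position z (Γ.target k i)).re) :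
    HasFDerivAt (Γ.edgeAngle k i) ((angleDeriv (z k) (position z (Γ.target k i))).comp
      (.prod (.proj k) (positionDeriv (Γ.target k i)))) z := by
  have := Fintype.ofFinite V
  have hpair : HasFDerivAt (fun z => (z k, position z (Γ.target k i))) _ z :=
    (hasFDerivAt_apply k z).prodMk (hasFDerivAt_position (Γ.target k i) z)
  exact (hasFDerivAt_angle hk h).comp z hpair

variable [DecidableEq V]

theorem fderiv_edgeAngle_single [Finite V] (hk : (z k).im ≠ 0)
    (h : (z k).re ≠ (position z (Γ.target k i)).re) {l : V} (hl : Γ.target k i ≠ Sum.inl l)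
    (v : ℂ) : fderiv ℝ (Γ.edgeAngle k i) z (Pi.single l v) =
      angleDeriv (z k) (position z (Γ.target k i)) (Pi.single (M := fun _ => ℂ) l v k, 0) := by
  rw [(Γ.hasFDerivAt_edgeAngle hk h).fderiv, ← positionDeriv_single_of_ne hl v]
  rfl

theorem angleFormDensity_eq_prod_angleWedge [Fintype V] {α : Type*} [LinearOrder α] (d : V → α)
    (hd : ∀ k i l, Γ.target k i = Sum.inl l → d l < d k) (him : ∀ k, (z k).im ≠ 0)
    (hre : ∀ k i, (z k).re ≠ (position z (Γ.target k i)).re) :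
    Γ.angleFormDensity z =
      ∏ k, angleWedge (z k) (position z (Γ.target k 0)) (position z (Γ.target k 1)) := by
  rw [angleFormDensity, det_eq_prod_det_submatrix_of_lt d]
  · refine Finset.prod_congr rfl fun k _ => ?_
    have hdiag (i : Fin 2) (v : ℂ) : fderiv ℝ (Γ.edgeAngle k i) z (Pi.single k v) =
        (2 * π)⁻¹ * (angleLogDeriv (z k) (position z (Γ.target k i)) * v).im := by
      rw [Γ.fderiv_edgeAngle_single (him k) (hre k i) (Γ.no_loop k i), Pi.single_eq_same,
        angleDeriv_apply_zero]
    rw [Matrix.det_fin_two]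
    simp only [Matrix.submatrix_apply, Matrix.of_apply, hdiag]
    simp only [angleWedge, Matrix.cons_val_zero, Matrix.cons_val_one, mul_one, mul_im, I_im, I_re,
      mul_zero, add_zero, conj_im, conj_re]
    ring
  · intro k l i j hne hkl
    by_contra hlt
    refine hne ?_
    rw [Matrix.of_apply, Γ.fderiv_edgeAngle_single (him k) (hre k i) fun hl => hlt (hd k i l hl),
      Pi.single_eq_of_ne hkl]
    exact (angleDeriv _ _).map_zero

end KontsevichGraph

section ConfigSpace

theorem ae_linearMap_apply_ne {E : Type*} [NormedAddCommGroup E] [NormedSpace ℝ E]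
    [FiniteDimensional ℝ E] [MeasurableSpace E] [BorelSpace E] (μ : Measure E) [μ.IsAddHaarMeasure]
    {ℓ : E →ₗ[ℝ] ℝ} (hℓ : ℓ ≠ 0) (c : ℝ) : ∀ᵐ x ∂μ, ℓ x ≠ c := by
  have htop : (AffineSubspace.mk' c ⊥).comap ℓ.toAffineMap ≠ ⊤ := by
    obtain ⟨x, hx⟩ := LinearMap.surjective hℓ (c + 1)
    intro htop
    have hmem : x ∈ (AffineSubspace.mk' c ⊥).comap ℓ.toAffineMap := htop ▸ AffineSubspace.mem_top ..
    simp [hx] at hmem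
  have hnull := Measure.addHaar_affineSubspace μ _ htop
  rw [ae_iff]
  convert hnull using 2
  ext x
  simp [sub_eq_zero]

variable {V : Type*} [Fintype V]

theorem ae_re_ne_re_position {k : V} {s : V ⊕ Fin 2} (hs : s ≠ Sum.inl k) :
    ∀ᵐ z : V → ℂ, (z k).re ≠ (KontsevichGraph.position z s).re := by
  classical
  let ℓ : (V → ℂ) →ₗ[ℝ] ℝ := reLm ∘ₗ (LinearMap.proj k - (positionDeriv s).toLinearMap)
  have hℓ : ℓ ≠ 0 := fun h => by
    have hone : (1 - positionDeriv s (Pi.single k 1)).re = 0 := by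
      simpa [ℓ] using LinearMap.congr_fun h (Pi.single k 1)
    rw [positionDeriv_single_of_ne hs] at hone
    simp at hone
  filter_upwards [ae_linearMap_apply_ne volume hℓ (KontsevichGraph.position 0 s).re] with z hz
  rw [position_eq_positionDeriv_add, add_re]
  intro h
  exact hz (by simp [ℓ, h])

theorem configSpace_ae_eq : configSpace V =ᵐ[volume] univ.pi fun _ => upperHalfPlaneSet := by
  have hdistinct : ∀ᵐ z : V → ℂ, ∀ k l, k ≠ l → (z k).re ≠ (z l).re :=
    ae_all_iff.2 fun k => ae_all_iff.2 fun l => ae_all_iff.2 fun hkl =>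
      ae_re_ne_re_position (s := Sum.inl l) (Sum.inl_injective.ne hkl.symm)
  filter_upwards [hdistinct] with z hz
  refine propext ⟨fun h k _ => h.1 k, fun h => ⟨fun k => h k trivial, fun k l hkl => ?_⟩⟩
  by_contra hne
  exact hz k l hne (congrArg re hkl)

theorem volume_restrict_configSpace :
    (volume : Measure (V → ℂ)).restrict (configSpace V) = Measure.pi fun _ => halfPlaneMeasure := by
  rw [Measure.restrict_congr_set configSpace_ae_eq]
  exact Measure.restrict_pi_pi (fun _ => volume) fun _ => upperHalfPlaneSet

end ConfigSpace

namespace RootedTreeOn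

variable {V : Type*}

theorem kontsevichTree_target_one (t : RootedTreeOn V) (k : V) :
    t.kontsevichTree.target k 1 = (t.parent k).elim (Sum.inr 1) Sum.inl := by
  simp only [kontsevichTree]
  cases t.parent k <;> rfl

theorem parent_eq_of_kontsevichTree_target_eq (t : RootedTreeOn V) {k l : V} {i : Fin 2}
    (h : t.kontsevichTree.target k i = Sum.inl l) : t.parent k = some l := by
  fin_cases i
  · cases h
  · change t.kontsevichTree.target k 1 = Sum.inl l at h
    rw [kontsevichTree_target_one] at h
    cases hk : t.parent k with
    | none => simp [hk] at h
    | some w => simpa [hk] using h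

variable [Fintype V] [DecidableEq V]

theorem angleFormDensity_ae_eq_density (t : RootedTreeOn V) :
    t.kontsevichTree.angleFormDensity =ᵐ[Measure.pi fun _ => halfPlaneMeasure] t.density 1 := by
  rw [← volume_restrict_configSpace, Filter.EventuallyEq,
    ae_restrict_congr_set configSpace_ae_eq]
  have hre : ∀ᵐ z : V → ℂ, ∀ k i,
      (z k).re ≠ (KontsevichGraph.position z (t.kontsevichTree.target k i)).re :=
    ae_all_iff.2 fun k => ae_all_iff.2 fun i =>
      ae_re_ne_re_position (t.kontsevichTree.no_loop k i)
  filter_upwards [ae_restrict_of_ae hre,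
    ae_restrict_mem (.univ_pi fun _ => isOpen_upperHalfPlaneSet.measurableSet)] with z hz him
  rw [t.kontsevichTree.angleFormDensity_eq_prod_angleWedge
    (fun k => (t.wellFounded_parent.apply k).rank)
    (fun k _ _ h => (t.wellFounded_parent.apply k).rank_lt_of_rel
      (t.parent_eq_of_kontsevichTree_target_eq h))
    (fun k => (him k trivial).ne') hz]
  refine Finset.prod_congr rfl fun k _ => congrArg (angleWedge (z k) 0) ?_
  rw [kontsevichTree_target_one]
  cases t.parent k <;> rfl

theorem Iso.integrableOn_angleFormDensity {t : RootedTreeOn V} {e : BracketTree}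
    (σ : t.Iso e.toRootedTree) :
    IntegrableOn t.kontsevichTree.angleFormDensity (configSpace V) := by
  rw [IntegrableOn, volume_restrict_configSpace, integrable_congr t.angleFormDensity_ae_eq_density,
    σ.integrable_density_iff]
  exact e.integrable_density one_ne_zero one_im.ge

theorem Iso.weight_eq {t : RootedTreeOn V} {e : BracketTree} (σ : t.Iso e.toRootedTree) :
    t.weight = e.I 0 := by
  rw [RootedTreeOn.weight, KontsevichGraph.weight, volume_restrict_configSpace,
    integral_congr_ae t.angleFormDensity_ae_eq_density, σ.integral_density_eq,
    e.integral_density one_ne_zero one_im.ge, arg_one, zero_div]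

end RootedTreeOn

theorem BracketTree.weight_toRootedTree (e : BracketTree) : e.toRootedTree.weight = e.I 0 :=
  (RootedTreeOn.Iso.ofEquiv (.refl _) rfl fun _ _ h => h).weight_eq

theorem mainTheorem2 :
    (∀ {V : Type*} [Fintype V] [DecidableEq V] (t : RootedTreeOn V),
      -- the angle form is absolutely integrable, so that the weight is well defined
      IntegrableOn t.kontsevichTree.angleFormDensity (configSpace V) ∧
      -- every rooted tree belongs to a topological rooted tree
      (∃ e : BracketTree, Nonempty (t.Iso e.toRootedTree)) ∧
      -- the weight of every representative of the topological rooted tree `e` is `I_e(0)`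
      (∀ e : BracketTree, Nonempty (t.Iso e.toRootedTree) → t.weight = e.I 0)) ∧
    (BracketTree.bullet).toRootedTree.weight = 1 / 2 ∧
    (BracketTree.graft 0 ![.bullet]).toRootedTree.weight = 1 / 12 ∧
    (BracketTree.graft 1 ![.bullet, .bullet]).toRootedTree.weight = 1 / 24 ∧
    (BracketTree.graft 0 ![.graft 0 ![.bullet]]).toRootedTree.weight = 0 := by
  refine ⟨fun {V} _ _ t => ?_, ?_, ?_, ?_, ?_⟩
  · obtain ⟨e, ⟨σ⟩⟩ := t.exists_iso_bracketTree
    exact ⟨σ.integrableOn_angleFormDensity, ⟨e, ⟨σ⟩⟩, fun _ ⟨σ'⟩ => σ'.weight_eq⟩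
  all_goals rw [BracketTree.weight_toRootedTree]
  · norm_num [BracketTree.I_bullet, bernoulliFun_eval_zero]
  · norm_num [BracketTree.I_graft_bullet, bernoulliFun_eval_zero]
  · norm_num [BracketTree.I_graft_bullet_bullet, bernoulliFun_eval_zero,
      bernoulli_eq_zero_of_odd (n := 3) (by decide)]
  · norm_num [BracketTree.I_graft_graft_bullet, bernoulliFun_eval_zero,
      bernoulli_eq_zero_of_odd (n := 3) (by decide)]
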